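/- Let $\mathbb K=\mathbb R$ or $\mathbb C$ and let $\mathfrak g$ be a finite-dimensional simple Lie algebra over $\mathbb K$ of rank (dimension of a Cartan subalgebra) bigger than one; if $\mathbb K=\mathbb R$, assume that $\mathfrak g$ is not the underlying real Lie algebra of a complex Lie algebra. Let $\mathfrak g=\mathfrak g_{-1}\oplus\mathfrak g_0\oplus\mathfrak g_1$ be a $|1|$-grading, i.e. $[\mathfrak g_i,\mathfrak g_j]\subset\mathfrak g_{i+j}$ with $\mathfrak g_k=0$ for $k\notin\{-1,0,1\}$, and $\mathfrak g_{-1}\neq 0$. Let $\mathfrak g_0^{ss}=[\mathfrak g_0,\mathfrak g_0]$ be the semisimple part of the reductive Lie algebra $\mathfrak g_0$. Let $B$ be the Killing form of $\mathfrak g$, and view $\mathsf P\in\mathfrak g_1\otimes\mathfrak g_1$ as a linear map $\mathsf P:\mathfrak g_{-1}\to\mathfrak g_1$, where $Z\otimes W$ is the map $X\mapsto B(Z,X)W$. All tensor products are over $\mathbb K$, and $S^2\mathfrak g_1\subset\mathfrak g_1\otimes\mathfrak g_1$ is the space of symmetric tensors. For $X,Y\in\mathfrak g_{-1}$ put $$\partial\mathsf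 P(X,Y)=[\mathsf P(X),Y]-[\mathsf P(Y),X].$$ Then the map $(\mathsf P,X,Y)\mapsto\partial\mathsf P(X,Y)$ induces 1. a well-defined surjective linear map $S^2\mathfrak g_1\otimes\mathfrak g_{-1}\otimes\mathfrak g_{-1}\to\mathfrak g_0^{ss}$ (in particular $\partial\mathsf P(X,Y)\in\mathfrak g_0^{ss}$ for every symmetric $\mathsf P$), and 2. a surjective linear map $\mathfrak g_1\otimes\mathfrak g_1\otimes\mathfrak g_{-1}\otimes\mathfrak g_{-1}\to\mathfrak g_0$. -/

import Mathlib

open scoped TensorProduct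

/-- A `|1|`-grading `g = g_{-1} ⊕ g_0 ⊕ g_1` of a Lie algebra `g` over `𝕜`, written as a family of
subspaces indexed by `ℤ` that vanish outside degrees `-1, 0, 1`. The trivial grading `g = g_0` is
excluded. -/
structure OneGrading (𝕜 g : Type*) [Field 𝕜] [LieRing g] [LieAlgebra 𝕜 g] where
  /-- The grading component of degree `i`. -/
  comp : ℤ → Submodule 𝕜 g
  isInternal : DirectSum.IsInternal comp
  lie_mem : ∀ (i j : ℤ) (x y : g), x ∈ comp i → y ∈ comp j → ⁅x, y⁆ ∈ comp (i + j)
  comp_eq_bot : ∀ k : ℤ, k ≠ -1 → k ≠ 0 → k ≠ 1 → comp k = ⊥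
  comp_neg_one_ne_bot : comp (-1) ≠ ⊥

/-- The Lie algebra `g` carries a complex structure compatible with the bracket: a linear `J` with
`J² = -1` and `[J x, y] = J [x, y]`. For `𝕜 = ℝ` this says that `g` is the real Lie algebra
underlying a complex Lie algebra. -/
def HasComplexStructure (𝕜 g : Type*) [Field 𝕜] [LieRing g] [LieAlgebra 𝕜 g] : Prop :=
  ∃ J : g →ₗ[𝕜] g, (∀ x, J (J x) = -x) ∧ ∀ x y, ⁅J x, y⁆ = J ⁅x, y⁆

namespace OneGrading

variable {𝕜 g : Type*} [Field 𝕜] [LieRing g] [LieAlgebra 𝕜 g] (G : OneGrading 𝕜 g)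

/-- The Lie subalgebra `g_0`. -/
def zero : LieSubalgebra 𝕜 g :=
  { G.comp 0 with
    lie_mem' := fun {x y} hx hy => by simpa using G.lie_mem 0 0 x y hx hy }

/-- The semisimple part `g_0^{ss} = [g_0, g_0]` of (the reductive Lie algebra) `g_0`. -/
def zeroSS : LieIdeal 𝕜 G.zero := ⁅(⊤ : LieIdeal 𝕜 G.zero), (⊤ : LieIdeal 𝕜 G.zero)⁆

/-- The map `g_1 → (g_{-1})^*`, `Z ↦ B(Z, ·)`, where `B` is the Killing form of `g`. -/
noncomputable def killingDual : G.comp 1 →ₗ[𝕜] Module.Dual 𝕜 (G.comp (-1)) :=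
  (killingForm 𝕜 g).domRestrict₁₂ (G.comp 1) (G.comp (-1))

/-- Elements of `g_1 ⊗ g_1` viewed as linear maps `g_{-1} → g_1` via the Killing form:
`Z ⊗ W` is the map `X ↦ B(Z, X) W`. -/
noncomputable def toHom :
    G.comp 1 ⊗[𝕜] G.comp 1 →ₗ[𝕜] (G.comp (-1) →ₗ[𝕜] G.comp 1) :=
  dualTensorHom 𝕜 (G.comp (-1)) (G.comp 1) ∘ₗ TensorProduct.map G.killingDual LinearMap.id

/-- `∂P(X, Y) = [P(X), Y] - [P(Y), X]` for a linear map `P : g_{-1} → g_1`. -/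
def del (P : G.comp (-1) →ₗ[𝕜] G.comp 1) (X Y : G.comp (-1)) : g :=
  ⁅(P X : g), (Y : g)⁆ - ⁅(P Y : g), (X : g)⁆

/-- `S² g_1`, as the space of symmetric tensors in `g_1 ⊗ g_1`. -/
noncomputable def symSq : Submodule 𝕜 (G.comp 1 ⊗[𝕜] G.comp 1) :=
  LinearMap.eqLocus (TensorProduct.comm 𝕜 (G.comp 1) (G.comp 1)).toLinearMap LinearMap.id

end OneGrading

/-!
The argument is a computation of orthogonal complements for the Killing form `B`.

By Cartan's criterion `B` is nondegenerate and every derivation of `g` is inner, so there is a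
grading element `E ∈ g₀` acting on the component of degree `i` as multiplication by `i`
(`OneGrading.exists_isGradingElement`). Hence `B` is nondegenerate on `g₀` and pairs `g₁` with
`g₋₁` nondegenerately, and an inclusion between subspaces of `g₀` may be checked on orthogonal
complements in `g₀` (`OneGrading.IsGradingElement.le_of_forall_killingForm_eq_zero`). By invariance,
for `b ∈ g₀`,

`B(b, ∂(Z ⊗ W)(X, Y)) = B(Z, X) B([b, W], Y) - B(Z, Y) B([b, W], X)`,

and this vanishes for all `X, Y` only if `[b, W]` is a multiple of `Z` (for `Z ≠ 0`).

* If `b` is orthogonal to the image of the symmetric tensors, take `Z = W`: every vector of `g₁` is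
  an eigenvector of `ad b`, so `ad b` is a scalar on `g₁`. Since `g₀` acts faithfully on `g₁`, `b` is
  a multiple of `E`, which is orthogonal to `[g₀, g₀]`. So the image contains `[g₀, g₀]`.
* Conversely, the orthogonal complement of `[g₀, g₀]` in `g₀` is the centre of `g₀`, and
  `B(E, ∂P(X, Y)) = B(P X, Y) - B(P Y, X)` vanishes for symmetric `P`. So the image lies in
  `[g₀, g₀]` once the centre of `g₀` is spanned by `E`
  (`OneGrading.IsGradingElement.exists_eq_smul_of_mem_center`). To see this, extend the action on
  `g₁` of a central element of `g₀` to an element of the centroid of `g`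
  (`OneGrading.IsGradingElement.exists_mem_lieCentroid`). By Schur's lemma the centroid consists of
  scalars, or else it contains a complex structure
  (`exists_eq_smul_one_of_mem_lieCentroid`).
* If `b` is orthogonal to the image of all tensors, `[b, W]` is a multiple of every nonzero `Z`, so it
  vanishes as soon as `dim g₁ > 1`, and `b = 0`. If `dim g₁ = 1`, then `g₀` is spanned by `E`, and it
  is the generalized null space of `ad E`, so `g` has rank at most one
  (`OneGrading.IsGradingElement.exists_notMem_span`).
-/

/-! ### The centroid of a simple Lie algebra -/

section Centroid

variable {𝕜 g : Type*} [LieRing g]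

/-- The centroid of a Lie algebra: the linear endomorphisms that commute with the adjoint action. -/
def lieCentroid (𝕜 g : Type*) [Field 𝕜] [LieRing g] [LieAlgebra 𝕜 g] :
    Subalgebra 𝕜 (Module.End 𝕜 g) where
  carrier := {T | ∀ x y : g, T ⁅x, y⁆ = ⁅x, T y⁆}
  mul_mem' := fun {S T} hS hT x y => by
    simp only [Set.mem_ofPred_eq] at hS hT
    simp only [Module.End.mul_apply, hT x y, hS]
  add_mem' := fun {S T} hS hT x y => by
    simp only [Set.mem_ofPred_eq] at hS hT
    simp only [LinearMap.add_apply, hT x y, hS x y, lie_add]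
  algebraMap_mem' := fun c x y => by
    simp [Module.algebraMap_end_apply]

theorem mem_lieCentroid [Field 𝕜] [LieAlgebra 𝕜 g] {T : Module.End 𝕜 g} :
    T ∈ lieCentroid 𝕜 g ↔ ∀ x y : g, T ⁅x, y⁆ = ⁅x, T y⁆ := Iff.rfl

/-- Schur's lemma: the kernel of an element of the centroid is an ideal. -/
theorem eq_zero_of_mem_lieCentroid [Field 𝕜] [LieAlgebra 𝕜 g] [LieAlgebra.IsSimple 𝕜 g]
    {T : Module.End 𝕜 g} (hT : T ∈ lieCentroid 𝕜 g) {x : g} (hx : x ≠ 0) (hTx : T x = 0) :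
    T = 0 := by
  let I : LieIdeal 𝕜 g :=
    { LinearMap.ker T with
      lie_mem := fun {u m} hm => by
        have hm' : T m = 0 := hm
        change T ⁅u, m⁆ = 0
        rw [mem_lieCentroid.1 hT u m, hm', lie_zero] }
  have hmem : ∀ y, y ∈ I ↔ T y = 0 := fun y => Iff.rfl
  rcases LieAlgebra.IsSimple.eq_bot_or_eq_top (R := 𝕜) I with h | h
  · exact absurd ((LieSubmodule.mem_bot (R := 𝕜) (L := g) x).1 (h ▸ (hmem x).2 hTx)) hx
  · ext y
    exact (hmem y).1 (h ▸ LieSubmodule.mem_top y)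

theorem eq_zero_or_eq_zero_of_mul_mem_lieCentroid [Field 𝕜] [LieAlgebra 𝕜 g]
    [LieAlgebra.IsSimple 𝕜 g] {S T : Module.End 𝕜 g} (hS : S ∈ lieCentroid 𝕜 g)
    (hST : S * T = 0) : S = 0 ∨ T = 0 := by
  by_cases hT : T = 0
  · exact Or.inr hT
  · obtain ⟨x, hx⟩ : ∃ x, T x ≠ 0 := by
      by_contra! h
      exact hT (LinearMap.ext h)
    exact Or.inl (eq_zero_of_mem_lieCentroid hS hx (by simpa using LinearMap.congr_fun hST x))

/-- By Schur's lemma, some irreducible factor of the minimal polynomial already annihilates an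
element of the centroid. -/
theorem exists_irreducible_aeval_eq_zero [Field 𝕜] [LieAlgebra 𝕜 g] [FiniteDimensional 𝕜 g]
    [LieAlgebra.IsSimple 𝕜 g] [Nontrivial g]
    {T : Module.End 𝕜 g} (hT : T ∈ lieCentroid 𝕜 g) :
    ∃ q : Polynomial 𝕜, Irreducible q ∧ Polynomial.aeval T q = 0 := by
  have key : ∀ p : Polynomial 𝕜, p ≠ 0 → Polynomial.aeval T p = 0 →
      ∃ q : Polynomial 𝕜, Irreducible q ∧ Polynomial.aeval T q = 0 := by
    intro p
    induction p using WfDvdMonoid.induction_on_irreducible with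
    | zero => intro h; exact absurd rfl h
    | unit u hu =>
      intro _ h
      exact absurd (h ▸ hu.map (Polynomial.aeval T)) not_isUnit_zero
    | mul a i ha hi ih =>
      intro _ h
      rw [map_mul] at h
      have hi' : Polynomial.aeval T i ∈ lieCentroid 𝕜 g :=
        Algebra.adjoin_le (Set.singleton_subset_iff.2 hT)
          (Polynomial.aeval_mem_adjoin_singleton 𝕜 T)
      rcases eq_zero_or_eq_zero_of_mul_mem_lieCentroid hi' h with h' | h'
      · exact ⟨i, hi, h'⟩
      · exact ih ha h'
  exact key _ (minpoly.ne_zero (Algebra.IsIntegral.isIntegral T)) (minpoly.aeval 𝕜 T)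

theorem exists_eq_smul_one_of_natDegree_eq_one [Field 𝕜] [LieAlgebra 𝕜 g] {T : Module.End 𝕜 g}
    {q : Polynomial 𝕜} (hd : q.natDegree = 1) (hqT : Polynomial.aeval T q = 0) :
    ∃ c : 𝕜, T = c • 1 := by
  have hlead : q.coeff 1 ≠ 0 := by
    rw [← hd, Polynomial.coeff_natDegree, Polynomial.leadingCoeff_ne_zero]
    rintro rfl
    simp at hd
  rw [Polynomial.aeval_eq_sum_range, hd] at hqT
  refine ⟨-(q.coeff 0 / q.coeff 1), ?_⟩
  simp only [Finset.sum_range_succ, Finset.range_zero, Finset.sum_empty, zero_add, pow_zero,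
    pow_one] at hqT
  have h : T = (q.coeff 1)⁻¹ • (q.coeff 1 • T) := by rw [inv_smul_smul₀ hlead]
  rw [h, eq_neg_of_add_eq_zero_right hqT, smul_neg, smul_smul, ← neg_smul, div_eq_inv_mul]

/-- Over `ℝ` (or a copy of it), the square of a suitable translate of an element of the centroid
is a scalar. -/
theorem exists_add_smul_sq_eq_smul [RCLike 𝕜] [LieAlgebra 𝕜 g] [FiniteDimensional 𝕜 g]
    [LieAlgebra.IsSimple 𝕜 g] [Nontrivial g] (hI : (RCLike.I : 𝕜) = 0)
    {T : Module.End 𝕜 g} (hT : T ∈ lieCentroid 𝕜 g) :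
    (∃ c : 𝕜, T = c • 1) ∨ ∃ a d : 𝕜, (T + a • 1) * (T + a • 1) = d • 1 := by
  obtain ⟨q, hq, hqT⟩ := exists_irreducible_aeval_eq_zero hT
  have hdeg : q.natDegree ≤ 2 := by
    have h := (MulEquiv.irreducible_iff
      (Polynomial.mapEquiv (RCLike.realRingEquiv hI)).toMulEquiv).2 hq
    have h2 := h.natDegree_le_two
    change (q.map ((RCLike.realRingEquiv hI : 𝕜 →+* ℝ))).natDegree ≤ 2 at h2
    rwa [Polynomial.natDegree_map] at h2
  have hq0 : q ≠ 0 := hq.ne_zero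
  have hpos : 0 < q.natDegree := hq.natDegree_pos
  have hlead : q.coeff q.natDegree ≠ 0 := by simpa using hq0
  obtain hd | hd : q.natDegree = 1 ∨ q.natDegree = 2 := by omega
  · exact Or.inl (exists_eq_smul_one_of_natDegree_eq_one hd hqT)
  · rw [Polynomial.aeval_eq_sum_range, hd] at hqT
    rw [hd] at hlead
    simp only [Finset.sum_range_succ, Finset.range_zero, Finset.sum_empty, zero_add, pow_zero,
      pow_one] at hqT
    have h : T ^ 2 = (q.coeff 2)⁻¹ • (q.coeff 2 • T ^ 2) := by rw [inv_smul_smul₀ hlead]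
    rw [eq_neg_of_add_eq_zero_right hqT] at h
    -- complete the square
    refine Or.inr ⟨q.coeff 1 / (2 * q.coeff 2),
      (q.coeff 1 / (2 * q.coeff 2)) ^ 2 - q.coeff 0 / q.coeff 2, ?_⟩
    have h1 : (T + (q.coeff 1 / (2 * q.coeff 2)) • (1 : Module.End 𝕜 g)) *
        (T + (q.coeff 1 / (2 * q.coeff 2)) • (1 : Module.End 𝕜 g)) =
        T ^ 2 + (2 * (q.coeff 1 / (2 * q.coeff 2))) • T +
          ((q.coeff 1 / (2 * q.coeff 2)) ^ 2) • 1 := by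
      simp only [add_mul, mul_add, smul_mul_assoc, mul_smul_comm, one_mul, mul_one, pow_two T]
      module
    have h2 : 2 * (q.coeff 1 / (2 * q.coeff 2)) = (q.coeff 2)⁻¹ * q.coeff 1 := by field_simp
    rw [h1, h, h2, div_eq_inv_mul (q.coeff 0)]
    module

/-- The centroid of a finite-dimensional simple Lie algebra over `ℝ` or `ℂ` consists of scalars,
unless the Lie algebra is real and carries a complex structure: over `ℂ` there is an eigenvalue,
and over `ℝ` a non-scalar element of the centroid is, up to translation and rescaling, a complex
structure. -/
theorem exists_eq_smul_one_of_mem_lieCentroid [RCLike 𝕜] [LieAlgebra 𝕜 g] [FiniteDimensional 𝕜 g]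
    [LieAlgebra.IsSimple 𝕜 g] (hreal : (RCLike.I : 𝕜) = 0 → ¬ HasComplexStructure 𝕜 g)
    {T : Module.End 𝕜 g} (hT : T ∈ lieCentroid 𝕜 g) : ∃ c : 𝕜, T = c • 1 := by
  have hone : (1 : Module.End 𝕜 g) ∈ lieCentroid 𝕜 g := one_mem _
  rcases subsingleton_or_nontrivial g with hg | hg
  · exact ⟨0, Subsingleton.elim _ _⟩
  rcases RCLike.I_eq_zero_or_im_I_eq_one (K := 𝕜) with hI | hI
  · rcases exists_add_smul_sq_eq_smul hI hT with h | ⟨a, d, h⟩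
    · exact h
    set S := T + a • (1 : Module.End 𝕜 g) with hS
    have hSc : S ∈ lieCentroid 𝕜 g := add_mem hT (Subalgebra.smul_mem _ hone a)
    have hd : ((RCLike.re d : ℝ) : 𝕜) = d := (RCLike.realRingEquiv hI).symm_apply_apply d
    rcases le_or_gt 0 (RCLike.re d) with hpos | hneg
    · set s : 𝕜 := ((Real.sqrt (RCLike.re d) : ℝ) : 𝕜)
      have hs : s * s = d := by
        rw [← RCLike.ofReal_mul, Real.mul_self_sqrt hpos, hd]
      have hmul : (S - s • 1) * (S + s • 1) = 0 := by
        simp only [sub_mul, mul_add, smul_mul_assoc, mul_smul_comm, one_mul, mul_one, h]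
        rw [← hs]
        module
      rcases eq_zero_or_eq_zero_of_mul_mem_lieCentroid
        (sub_mem hSc (Subalgebra.smul_mem _ hone s)) hmul with h' | h'
      · exact ⟨s - a, by rw [sub_smul, ← sub_eq_zero.1 h', hS]; abel⟩
      · exact ⟨-s - a, by rw [sub_smul, neg_smul, ← eq_neg_of_add_eq_zero_left h', hS]; abel⟩
    · exfalso
      set s : 𝕜 := ((Real.sqrt (-RCLike.re d) : ℝ) : 𝕜) with hsdef
      have hs : s * s = -d := by
        rw [← RCLike.ofReal_mul, Real.mul_self_sqrt (by linarith), RCLike.ofReal_neg, hd]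
      have hs0 : s ≠ 0 := by
        rw [hsdef, RCLike.ofReal_ne_zero]
        exact (Real.sqrt_pos.2 (by linarith)).ne'
      refine hreal hI ⟨s⁻¹ • S, fun x => ?_, fun x y => ?_⟩
      · have h' := LinearMap.congr_fun h x
        simp only [Module.End.mul_apply, LinearMap.smul_apply, Module.End.one_apply] at h'
        rw [LinearMap.smul_apply, LinearMap.smul_apply, map_smul, h', smul_smul, smul_smul,
          ← mul_inv, hs, ← neg_neg d, hs.symm, neg_neg, mul_neg,
          inv_mul_cancel₀ (mul_ne_zero hs0 hs0), neg_one_smul]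
      · rw [LinearMap.smul_apply, LinearMap.smul_apply, ← lie_skew x y, map_neg,
          mem_lieCentroid.1 hSc y x, smul_lie, ← lie_skew (S x) y]
  · obtain ⟨q, hq, hqT⟩ := exists_irreducible_aeval_eq_zero hT
    have h := (MulEquiv.irreducible_iff
      (Polynomial.mapEquiv (RCLike.complexRingEquiv hI)).toMulEquiv).2 hq
    have h1 := Polynomial.natDegree_eq_of_degree_eq_some
      (IsAlgClosed.degree_eq_one_of_irreducible ℂ h)
    change (q.map ((RCLike.complexRingEquiv hI : 𝕜 →+* ℂ))).natDegree = 1 at h1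
    rw [Polynomial.natDegree_map] at h1
    exact exists_eq_smul_one_of_natDegree_eq_one h1 hqT

end Centroid

namespace OneGrading

/-! ### The grading element and the Killing form -/

section Grading

variable {𝕜 g : Type*} [Field 𝕜] [LieRing g] [LieAlgebra 𝕜 g] (G : OneGrading 𝕜 g)

theorem mem_comp_zero_of_lie {x y : g} (hx : x ∈ G.comp 1) (hy : y ∈ G.comp (-1)) :
    ⁅x, y⁆ ∈ G.comp 0 := by
  simpa using G.lie_mem 1 (-1) x y hx hy

theorem mem_comp_of_lie_zero {i : ℤ} {x y : g} (hx : x ∈ G.comp 0) (hy : y ∈ G.comp i) :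
    ⁅x, y⁆ ∈ G.comp i := by
  simpa using G.lie_mem 0 i x y hx hy

theorem lie_eq_zero_of_mem_comp_one {x y : g} (hx : x ∈ G.comp 1) (hy : y ∈ G.comp 1) :
    ⁅x, y⁆ = 0 := by
  have h := G.lie_mem 1 1 x y hx hy
  rwa [G.comp_eq_bot _ (by norm_num) (by norm_num) (by norm_num), Submodule.mem_bot] at h

theorem lie_eq_zero_of_mem_comp_neg_one {x y : g} (hx : x ∈ G.comp (-1)) (hy : y ∈ G.comp (-1)) :
    ⁅x, y⁆ = 0 := by
  have h := G.lie_mem (-1) (-1) x y hx hy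
  rwa [G.comp_eq_bot _ (by norm_num) (by norm_num) (by norm_num), Submodule.mem_bot] at h

theorem exists_eq_add (x : g) :
    ∃ a ∈ G.comp (-1), ∃ b ∈ G.comp 0, ∃ c ∈ G.comp 1, x = a + b + c := by
  have hx : x ∈ iSup G.comp := by
    rw [G.isInternal.submodule_iSup_eq_top]; exact Submodule.mem_top
  induction hx using Submodule.iSup_induction' with
  | mem i x hx =>
    by_cases h1 : i = -1
    · subst h1; exact ⟨x, hx, 0, zero_mem _, 0, zero_mem _, by simp⟩
    by_cases h2 : i = 0
    · subst h2; exact ⟨0, zero_mem _, x, hx, 0, zero_mem _, by simp⟩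
    by_cases h3 : i = 1
    · subst h3; exact ⟨0, zero_mem _, 0, zero_mem _, x, hx, by simp⟩
    rw [G.comp_eq_bot i h1 h2 h3, Submodule.mem_bot] at hx
    exact ⟨0, zero_mem _, 0, zero_mem _, 0, zero_mem _, by simp [hx]⟩
  | zero => exact ⟨0, zero_mem _, 0, zero_mem _, 0, zero_mem _, by simp⟩
  | add x y _ _ hx hy =>
    obtain ⟨a, ha, b, hb, c, hc, rfl⟩ := hx
    obtain ⟨a', ha', b', hb', c', hc', rfl⟩ := hy
    exact ⟨a + a', add_mem ha ha', b + b', add_mem hb hb', c + c', add_mem hc hc', by abel⟩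

/-- A linear statement about `g` may be checked on homogeneous elements. -/
theorem linearMap_ext {M : Type*} [AddCommGroup M] [Module 𝕜 M] {S T : g →ₗ[𝕜] M}
    (hneg : ∀ x ∈ G.comp (-1), S x = T x) (hzero : ∀ x ∈ G.comp 0, S x = T x)
    (hpos : ∀ x ∈ G.comp 1, S x = T x) : S = T := by
  ext x
  obtain ⟨a, ha, b, hb, c, hc, rfl⟩ := G.exists_eq_add x
  simp only [map_add, hneg a ha, hzero b hb, hpos c hc]

/-- The linear map that multiplies the component of degree `i` by `i`. -/
theorem exists_linearMap_eq_smul :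
    ∃ D : g →ₗ[𝕜] g, ∀ (i : ℤ), ∀ x ∈ G.comp i, D x = (i : 𝕜) • x := by
  let dec := G.isInternal.chooseDecomposition
  let e := DirectSum.decomposeLinearEquiv G.comp
  let p (i : ℤ) : g →ₗ[𝕜] g :=
    (G.comp i).subtype ∘ₗ DirectSum.component 𝕜 ℤ (fun i => G.comp i) i ∘ₗ e.toLinearMap
  have hsame : ∀ i, ∀ x ∈ G.comp i, p i x = x := fun i x hx =>
    DirectSum.decompose_of_mem_same G.comp hx
  have hne : ∀ i j, i ≠ j → ∀ x ∈ G.comp i, p j x = 0 := fun i j hij x hx =>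
    DirectSum.decompose_of_mem_ne G.comp hx hij
  refine ⟨p 1 - p (-1), fun i x hx => ?_⟩
  rw [LinearMap.sub_apply]
  by_cases h1 : i = -1
  · subst h1
    rw [hsame _ x hx, hne _ _ (by norm_num) x hx]; simp
  by_cases h2 : i = 0
  · subst h2
    rw [hne _ _ (by norm_num) x hx, hne _ _ (by norm_num) x hx]; simp
  by_cases h3 : i = 1
  · subst h3
    rw [hsame _ x hx, hne _ _ (by norm_num) x hx]; simp
  rw [G.comp_eq_bot i h1 h2 h3, Submodule.mem_bot] at hx
  simp [hx]

/-- `E` is a grading element: it acts on the component of degree `i` as multiplication by `i`. -/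
def IsGradingElement (E : g) : Prop :=
  ∀ (i : ℤ), ∀ x ∈ G.comp i, ⁅E, x⁆ = (i : 𝕜) • x

/-- Multiplication by the degree is a derivation, hence inner. -/
theorem exists_isGradingElement [FiniteDimensional 𝕜 g] [LieAlgebra.IsKilling 𝕜 g] :
    ∃ E, G.IsGradingElement E := by
  obtain ⟨D, hD⟩ := G.exists_linearMap_eq_smul
  have hhom : ∀ i j, ∀ x ∈ G.comp i, ∀ y ∈ G.comp j, D ⁅x, y⁆ = ⁅x, D y⁆ - ⁅y, D x⁆ := by
    intro i j x hx y hy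
    rw [hD _ _ (G.lie_mem i j x y hx hy), hD i x hx, hD j y hy, lie_smul, lie_smul,
      ← lie_skew x y]
    push_cast
    module
  let F : g →ₗ[𝕜] g →ₗ[𝕜] g :=
    (LieModule.toEnd 𝕜 g g : g →ₗ[𝕜] Module.End 𝕜 g).compr₂ D
  let H : g →ₗ[𝕜] g →ₗ[𝕜] g :=
    (LieModule.toEnd 𝕜 g g : g →ₗ[𝕜] Module.End 𝕜 g).compl₂ D -
      ((LieModule.toEnd 𝕜 g g : g →ₗ[𝕜] Module.End 𝕜 g).compl₂ D).flip
  have hFH : F = H := by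
    refine G.linearMap_ext ?_ ?_ ?_ <;> intro x hx <;> refine G.linearMap_ext ?_ ?_ ?_ <;>
      intro y hy <;> exact hhom _ _ x hx y hy
  let D' : LieDerivation 𝕜 g g :=
    { D with leibniz' := fun x y => LinearMap.congr_fun (LinearMap.congr_fun hFH x) y }
  obtain ⟨E, hE⟩ := LieDerivation.IsKilling.exists_eq_ad D'
  refine ⟨E, fun i x hx => ?_⟩
  rw [← hD i x hx]
  exact (LieDerivation.ad_apply_apply 𝕜 g E x).symm.trans (LieDerivation.congr_fun hE x)

variable {G}

theorem IsGradingElement.killingForm_eq_zero [CharZero 𝕜] {E : g} (hE : G.IsGradingElement E)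
    {i j : ℤ} (hij : i + j ≠ 0) {x y : g} (hx : x ∈ G.comp i) (hy : y ∈ G.comp j) :
    killingForm 𝕜 g x y = 0 := by
  have h := LieModule.traceForm_apply_lie_apply' 𝕜 g g E x y
  rw [hE i x hx, hE j y hy, map_smul, map_smul, LinearMap.smul_apply, smul_eq_mul,
    smul_eq_mul] at h
  have h' : ((i + j : ℤ) : 𝕜) * killingForm 𝕜 g x y = 0 := by
    push_cast
    linear_combination h
  exact (mul_eq_zero.1 h').resolve_left (Int.cast_ne_zero.2 hij)

theorem IsGradingElement.mem_comp_zero [CharZero 𝕜] {E x : g} (hE : G.IsGradingElement E)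
    (hx : ⁅E, ⁅E, x⁆⁆ = 0) : x ∈ G.comp 0 := by
  obtain ⟨a, ha, b, hb, c, hc, rfl⟩ := G.exists_eq_add x
  have h1 : ⁅E, a⁆ = -a := by simpa using hE (-1) a ha
  have h2 : ⁅E, b⁆ = 0 := by simpa using hE 0 b hb
  have h3 : ⁅E, c⁆ = c := by simpa using hE 1 c hc
  have h4 : a + c = 0 := by simpa [lie_add, h1, h2, h3] using hx
  have h5 : -a + c = 0 := by simpa [lie_add, h1, h2, h3, lie_neg] using congrArg (⁅E, ·⁆) h4
  have h6 : (2 : 𝕜) • c = 0 := by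
    rw [two_smul, ← add_zero (0 : g)]; nth_rw 1 [← h4]; rw [← h5]; abel
  have hc0 : c = 0 := (smul_eq_zero.1 h6).resolve_left two_ne_zero
  have ha0 : a = 0 := by simpa [hc0] using h4
  simpa [hc0, ha0] using hb

theorem IsGradingElement.mem [CharZero 𝕜] {E : g} (hE : G.IsGradingElement E) : E ∈ G.comp 0 :=
  hE.mem_comp_zero (by simp)

/-- The Killing form pairs the components of degree `i` and `-i` nondegenerately. -/
theorem IsGradingElement.eq_zero_of_forall_killingForm_eq_zero [CharZero 𝕜]
    [LieAlgebra.IsKilling 𝕜 g] {E : g} (hE : G.IsGradingElement E)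
    {i : ℤ} {x : g} (hx : x ∈ G.comp i) (h : ∀ y ∈ G.comp (-i), killingForm 𝕜 g x y = 0) :
    x = 0 := by
  have hker : killingForm 𝕜 g x = 0 := by
    have hall : ∀ j, ∀ y ∈ G.comp j, killingForm 𝕜 g x y = 0 := by
      intro j y hy
      by_cases hij : i + j = 0
      · obtain rfl : j = -i := by omega
        exact h y hy
      · exact hE.killingForm_eq_zero hij hx hy
    exact G.linearMap_ext (hall _) (hall _) (hall _)
  have hmem : x ∈ LinearMap.ker (killingForm 𝕜 g) := hker
  rwa [LieAlgebra.IsKilling.ker_killingForm_eq_bot, Submodule.mem_bot] at hmem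

/-- A subspace `W` of `g₀` contains a subspace `S` of `g₀` as soon as the orthogonal complement of
`W` in `g₀` is orthogonal to `S`. -/
theorem IsGradingElement.le_of_forall_killingForm_eq_zero [CharZero 𝕜] [FiniteDimensional 𝕜 g]
    [LieAlgebra.IsKilling 𝕜 g] {E : g} (hE : G.IsGradingElement E) {S W : Submodule 𝕜 g}
    (hS : S ≤ G.comp 0) (hW : W ≤ G.comp 0)
    (h : ∀ b ∈ G.comp 0, (∀ w ∈ W, killingForm 𝕜 g b w = 0) → ∀ s ∈ S, killingForm 𝕜 g b s = 0) :
    S ≤ W := by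
  intro s hs
  rw [← LinearMap.BilinForm.orthogonal_orthogonal
    (LieAlgebra.IsKilling.killingForm_nondegenerate 𝕜 g)
    (LieModule.traceForm_isSymm 𝕜 g g).isRefl W]
  intro x hx
  obtain ⟨a, ha, b, hb, c, hc, rfl⟩ := G.exists_eq_add x
  have key : ∀ y ∈ G.comp 0, killingForm 𝕜 g (a + b + c) y = killingForm 𝕜 g b y := by
    intro y hy
    rw [map_add, map_add, LinearMap.add_apply, LinearMap.add_apply,
      hE.killingForm_eq_zero (by norm_num) ha hy, hE.killingForm_eq_zero (by norm_num) hc hy]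
    simp
  change killingForm 𝕜 g (a + b + c) s = 0
  rw [key s (hS hs)]
  refine h b hb (fun w hw => ?_) s hs
  rw [← key w (hW hw), LieModule.traceForm_comm]
  exact hx w hw

end Grading

/-! ### The action of `g₀` on `g₁` and the centre of `g₀` -/

section Center

variable {𝕜 g : Type*} [Field 𝕜] [CharZero 𝕜] [LieRing g] [LieAlgebra 𝕜 g]
  {G : OneGrading 𝕜 g} {E : g}

/-- If `w` acts on `g₁` as `u` after `v`, then on `g₋₁`, which the Killing form makes dual to `g₁`
as a `g₀`-module, it acts as minus `v` after `u`. -/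
theorem IsGradingElement.lie_neg_one_eq [LieAlgebra.IsKilling 𝕜 g] (hE : G.IsGradingElement E)
    {u v w : g} (hu : u ∈ G.comp 0) (hv : v ∈ G.comp 0) (hw : w ∈ G.comp 0)
    (h : ∀ c ∈ G.comp 1, ⁅w, c⁆ = ⁅u, ⁅v, c⁆⁆) {a : g} (ha : a ∈ G.comp (-1)) :
    ⁅w, a⁆ = -⁅v, ⁅u, a⁆⁆ := by
  rw [← sub_eq_zero]
  refine hE.eq_zero_of_forall_killingForm_eq_zero (i := -1)
    (sub_mem (G.mem_comp_of_lie_zero hw ha)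
      (neg_mem (G.mem_comp_of_lie_zero hv (G.mem_comp_of_lie_zero hu ha)))) (fun c hc => ?_)
  rw [neg_neg] at hc
  have h1 := LieModule.traceForm_apply_lie_apply' 𝕜 g g w a c
  have h2 := LieModule.traceForm_apply_lie_apply' 𝕜 g g v ⁅u, a⁆ c
  have h3 := LieModule.traceForm_apply_lie_apply' 𝕜 g g u a ⁅v, c⁆
  rw [h c hc] at h1
  rw [map_sub, map_neg, LinearMap.sub_apply, LinearMap.neg_apply, h1, h2, h3]
  ring

theorem IsGradingElement.lie_neg_one_eq_zero [LieAlgebra.IsKilling 𝕜 g] (hE : G.IsGradingElement E)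
    {b : g} (hb : b ∈ G.comp 0) (h : ∀ c ∈ G.comp 1, ⁅b, c⁆ = 0) {a : g} (ha : a ∈ G.comp (-1)) :
    ⁅b, a⁆ = 0 := by
  have := hE.lie_neg_one_eq (u := 0) (v := 0) (w := b) (zero_mem _) (zero_mem _) hb
    (fun c hc => by simp [h c hc]) ha
  simpa using this

/-- The representation of `g₀` on `g₁` is faithful: its kernel is an ideal of `g`. -/
theorem IsGradingElement.eq_zero_of_forall_lie_eq_zero [LieAlgebra.IsKilling 𝕜 g]
    [LieAlgebra.IsSimple 𝕜 g] (hE : G.IsGradingElement E)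
    {b : g} (hb : b ∈ G.comp 0) (h : ∀ c ∈ G.comp 1, ⁅b, c⁆ = 0) : b = 0 := by
  let I : LieIdeal 𝕜 g :=
    { carrier := {b | b ∈ G.comp 0 ∧ ∀ c ∈ G.comp 1, ⁅b, c⁆ = 0}
      add_mem' := fun {x y} hx hy =>
        ⟨add_mem hx.1 hy.1, fun c hc => by rw [add_lie, hx.2 c hc, hy.2 c hc, add_zero]⟩
      zero_mem' := ⟨zero_mem _, fun c _ => zero_lie c⟩
      smul_mem' := fun t x hx =>
        ⟨Submodule.smul_mem _ t hx.1, fun c hc => by rw [smul_lie, hx.2 c hc, smul_zero]⟩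
      lie_mem := fun {u x} hx => by
        have hx0 : x ∈ G.comp 0 := hx.1
        obtain ⟨a, ha, b, hb, c, hc, rfl⟩ := G.exists_eq_add u
        have h1 : ⁅a, x⁆ = 0 := by
          rw [← lie_skew, hE.lie_neg_one_eq_zero hx0 hx.2 ha, neg_zero]
        have h2 : ⁅c, x⁆ = 0 := by rw [← lie_skew, hx.2 c hc, neg_zero]
        rw [add_lie, add_lie, h1, h2, zero_add, add_zero]
        refine ⟨G.mem_comp_of_lie_zero hb hx0, fun z hz => ?_⟩
        rw [lie_lie, hx.2 z hz, hx.2 _ (G.mem_comp_of_lie_zero hb hz), lie_zero, sub_zero] }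
  have hI : ∀ y, y ∈ I ↔ y ∈ G.comp 0 ∧ ∀ c ∈ G.comp 1, ⁅y, c⁆ = 0 := fun y => Iff.rfl
  rcases LieAlgebra.IsSimple.eq_bot_or_eq_top (R := 𝕜) I with h' | h'
  · exact (LieSubmodule.mem_bot (R := 𝕜) (L := g) b).1 (h' ▸ (hI b).2 ⟨hb, h⟩)
  · exfalso
    refine G.comp_neg_one_ne_bot ((Submodule.eq_bot_iff _).2 fun a ha => ?_)
    have ha0 : a ∈ G.comp 0 := ((hI a).1 (h' ▸ LieSubmodule.mem_top a)).1
    have h1 : ⁅E, a⁆ = -a := by simpa using hE (-1) a ha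
    have h2 : ⁅E, a⁆ = 0 := by simpa using hE 0 a ha0
    rwa [h1, neg_eq_zero] at h2

/-- `g₀` is spanned by the brackets of `g₁` with `g₋₁`. -/
theorem IsGradingElement.comp_zero_le_span [FiniteDimensional 𝕜 g] [LieAlgebra.IsKilling 𝕜 g]
    [LieAlgebra.IsSimple 𝕜 g] (hE : G.IsGradingElement E) :
    G.comp 0 ≤ Submodule.span 𝕜 {x | ∃ c ∈ G.comp 1, ∃ a ∈ G.comp (-1), ⁅c, a⁆ = x} := by
  refine hE.le_of_forall_killingForm_eq_zero le_rfl (Submodule.span_le.2 ?_) ?_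
  · rintro _ ⟨c, hc, a, ha, rfl⟩
    exact G.mem_comp_zero_of_lie hc ha
  · intro b hb h s _
    have hb0 : b = 0 := by
      refine hE.eq_zero_of_forall_lie_eq_zero hb fun c hc =>
        hE.eq_zero_of_forall_killingForm_eq_zero (G.mem_comp_of_lie_zero hb hc) fun a ha => ?_
      rw [LieModule.traceForm_apply_lie_apply]
      exact h _ (Submodule.subset_span ⟨c, hc, a, ha, rfl⟩)
    simp [hb0]

/-- For `A` central in `g₀`, left multiplication by `ad A` preserves the image of `g₀` in the
endomorphisms of `g₁`. -/
theorem IsGradingElement.exists_lie_eq_lie_lie [FiniteDimensional 𝕜 g] [LieAlgebra.IsKilling 𝕜 g]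
    [LieAlgebra.IsSimple 𝕜 g] (hE : G.IsGradingElement E) {A : g} (hA : A ∈ G.comp 0)
    (hcomm : ∀ b ∈ G.comp 0, ⁅A, b⁆ = 0) {b : g} (hb : b ∈ G.comp 0) :
    ∃ b' ∈ G.comp 0, ∀ c ∈ G.comp 1, ⁅b', c⁆ = ⁅A, ⁅b, c⁆⁆ := by
  have hb' := hE.comp_zero_le_span hb
  clear hb
  induction hb' using Submodule.span_induction with
  | mem x hx =>
    obtain ⟨c, hc, a, ha, rfl⟩ := hx
    refine ⟨⁅⁅A, c⁆, a⁆, G.mem_comp_zero_of_lie (G.mem_comp_of_lie_zero hA hc) ha,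
      fun z hz => ?_⟩
    have haz : ⁅a, z⁆ ∈ G.comp 0 := by
      rw [← lie_skew]; exact neg_mem (G.mem_comp_zero_of_lie hz ha)
    rw [lie_lie ⁅A, c⁆ a z, lie_lie c a z,
      G.lie_eq_zero_of_mem_comp_one (G.mem_comp_of_lie_zero hA hc) hz,
      G.lie_eq_zero_of_mem_comp_one hc hz, lie_zero, sub_zero, sub_zero, lie_lie,
      hcomm _ haz, lie_zero, sub_zero]
  | zero => exact ⟨0, zero_mem _, by simp⟩
  | add x y _ _ hx hy =>
    obtain ⟨x', hx0, hx'⟩ := hx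
    obtain ⟨y', hy0, hy'⟩ := hy
    exact ⟨x' + y', add_mem hx0 hy0, fun c hc => by
      rw [add_lie, add_lie, lie_add, hx' c hc, hy' c hc]⟩
  | smul t x _ hx =>
    obtain ⟨x', hx0, hx'⟩ := hx
    exact ⟨t • x', Submodule.smul_mem _ t hx0, fun c hc => by
      rw [smul_lie, smul_lie, lie_smul, hx' c hc]⟩

/-- The action on `g₁` of an element `A` of the centre of `g₀` extends to an element of the
centroid of `g`. On `g₋₁` it is `-ad A`, and on `g₀` it is left multiplication by `ad A` after
`g₀` is embedded into the endomorphisms of `g₁`. -/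
theorem IsGradingElement.exists_mem_lieCentroid [FiniteDimensional 𝕜 g] [LieAlgebra.IsKilling 𝕜 g]
    [LieAlgebra.IsSimple 𝕜 g] (hE : G.IsGradingElement E) {A : g} (hA : A ∈ G.comp 0)
    (hcomm : ∀ b ∈ G.comp 0, ⁅A, b⁆ = 0) :
    ∃ T ∈ lieCentroid 𝕜 g, ∀ c ∈ G.comp 1, T c = ⁅A, c⁆ := by
  choose! f hf0 hf using fun b hb => hE.exists_lie_eq_lie_lie hA hcomm (b := b) hb
  have huniq : ∀ b ∈ G.comp 0, ∀ b' ∈ G.comp 0,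
      (∀ c ∈ G.comp 1, ⁅b', c⁆ = ⁅A, ⁅b, c⁆⁆) → f b = b' := by
    intro b hb b' hb' h
    refine sub_eq_zero.1 (hE.eq_zero_of_forall_lie_eq_zero (sub_mem (hf0 b hb) hb') fun c hc => ?_)
    rw [sub_lie, hf b hb c hc, h c hc, sub_self]
  let T0 : G.comp 0 →ₗ[𝕜] g :=
    { toFun := fun b => f b
      map_add' := fun x y => by
        refine huniq _ (x + y).2 _ (add_mem (hf0 x x.2) (hf0 y y.2)) fun c hc => ?_
        rw [Submodule.coe_add, add_lie, add_lie, lie_add, hf x x.2 c hc, hf y y.2 c hc]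
      map_smul' := fun t x => by
        refine huniq _ (t • x).2 _ (Submodule.smul_mem _ t (hf0 x x.2)) fun c hc => ?_
        rw [Submodule.coe_smul, smul_lie, RingHom.id_apply, smul_lie, lie_smul, hf x x.2 c hc] }
  have hE1 : ∀ a ∈ G.comp (-1), ⁅E, a⁆ = -a := fun a ha => by simpa using hE (-1) a ha
  have hE2 : ∀ b ∈ G.comp 0, ⁅E, b⁆ = 0 := fun b hb => by simpa using hE 0 b hb
  have hE3 : ∀ c ∈ G.comp 1, ⁅E, c⁆ = c := fun c hc => by simpa using hE 1 c hc
  -- `1 - (ad E)²` is the projection onto `g₀`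
  let p : g →ₗ[𝕜] G.comp 0 :=
    (LinearMap.id - LieAlgebra.ad 𝕜 g E ∘ₗ LieAlgebra.ad 𝕜 g E).codRestrict (G.comp 0)
      (fun x => by
        obtain ⟨a, ha, b, hb, c, hc, rfl⟩ := G.exists_eq_add x
        have : a + b + c - ⁅E, ⁅E, a + b + c⁆⁆ = b := by
          simp only [lie_add, hE1 a ha, hE2 b hb, hE3 c hc, lie_neg, lie_zero]
          abel
        change a + b + c - ⁅E, ⁅E, a + b + c⁆⁆ ∈ G.comp 0
        rwa [this])
  let T : Module.End 𝕜 g := T0 ∘ₗ p + LieAlgebra.ad 𝕜 g A ∘ₗ LieAlgebra.ad 𝕜 g E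
  have hT : ∀ x, T x = f (x - ⁅E, ⁅E, x⁆⁆) + ⁅A, ⁅E, x⁆⁆ := fun x => rfl
  have hf00 : f 0 = 0 := T0.map_zero
  have hTneg : ∀ a ∈ G.comp (-1), T a = -⁅A, a⁆ := fun a ha => by
    rw [hT, hE1 a ha, lie_neg, hE1 a ha, neg_neg, sub_self, hf00, lie_neg, zero_add]
  have hTzero : ∀ b ∈ G.comp 0, T b = f b := fun b hb => by
    rw [hT, hE2 b hb, lie_zero, lie_zero, sub_zero, add_zero]
  have hTpos : ∀ c ∈ G.comp 1, T c = ⁅A, c⁆ := fun c hc => by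
    rw [hT, hE3 c hc, hE3 c hc, sub_self, hf00, zero_add]
  have hswap : ∀ b ∈ G.comp 0, ∀ x : g, ⁅A, ⁅b, x⁆⁆ = ⁅b, ⁅A, x⁆⁆ := fun b hb x => by
    rw [leibniz_lie A b x, hcomm b hb, zero_lie, zero_add]
  have hlie : ∀ a ∈ G.comp (-1), ∀ c ∈ G.comp 1, ⁅a, c⁆ ∈ G.comp 0 := fun a ha c hc => by
    rw [← lie_skew]; exact neg_mem (G.mem_comp_zero_of_lie hc ha)
  have hfneg : ∀ b ∈ G.comp 0, ∀ a ∈ G.comp (-1), ⁅f b, a⁆ = -⁅A, ⁅b, a⁆⁆ := fun b hb a ha => by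
    rw [hswap b hb]
    exact hE.lie_neg_one_eq hA hb (hf0 b hb) (hf b hb) ha
  have hfac : ∀ a ∈ G.comp (-1), ∀ c ∈ G.comp 1, f ⁅a, c⁆ = ⁅a, ⁅A, c⁆⁆ := fun a ha c hc => by
    have hAc := G.mem_comp_of_lie_zero hA hc
    refine huniq _ (hlie a ha c hc) _ (hlie a ha _ hAc) fun z hz => ?_
    rw [lie_lie a ⁅A, c⁆ z, lie_lie a c z, G.lie_eq_zero_of_mem_comp_one hAc hz,
      G.lie_eq_zero_of_mem_comp_one hc hz, lie_lie A c ⁅a, z⁆, hcomm _ (hlie a ha z hz),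
      lie_zero, lie_zero, zero_sub, zero_sub, sub_zero, lie_neg]
  let F : g →ₗ[𝕜] g →ₗ[𝕜] g :=
    (LieModule.toEnd 𝕜 g g : g →ₗ[𝕜] Module.End 𝕜 g).compr₂ T
  let H : g →ₗ[𝕜] g →ₗ[𝕜] g :=
    (LieModule.toEnd 𝕜 g g : g →ₗ[𝕜] Module.End 𝕜 g).compl₂ T
  have hFH : F = H := by
    refine G.linearMap_ext ?_ ?_ ?_ <;> intro u hu <;> refine G.linearMap_ext ?_ ?_ ?_ <;>
      intro y hy <;> change T ⁅u, y⁆ = ⁅u, T y⁆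
    · rw [hTneg y hy, G.lie_eq_zero_of_mem_comp_neg_one hu hy, map_zero, lie_neg,
        G.lie_eq_zero_of_mem_comp_neg_one hu (G.mem_comp_of_lie_zero hA hy), neg_zero]
    · rw [hTzero y hy, ← lie_skew, ← lie_skew u (f y), hfneg y hy u hu, map_neg,
        hTneg _ (G.mem_comp_of_lie_zero hy hu)]
    · rw [hTpos y hy, hTzero _ (hlie u hu y hy), hfac u hu y hy]
    · rw [hTneg y hy, hTneg _ (G.mem_comp_of_lie_zero hu hy), hswap u hu, lie_neg]
    · rw [hTzero y hy, hTzero _ (G.mem_comp_of_lie_zero hu hy)]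
      refine huniq _ (G.mem_comp_of_lie_zero hu hy) _ (G.mem_comp_of_lie_zero hu (hf0 y hy))
        fun z hz => ?_
      rw [lie_lie, lie_lie, lie_sub, hf y hy z hz, hf y hy _ (G.mem_comp_of_lie_zero hu hz),
        hswap u hu]
    · rw [hTpos y hy, hTpos _ (G.mem_comp_of_lie_zero hu hy), hswap u hu]
    · rw [hTneg y hy, ← lie_skew u y, map_neg, hTzero _ (hlie y hy u hu), hfac y hy u hu, lie_skew,
        lie_lie, hcomm _ (G.mem_comp_zero_of_lie hu hy), zero_sub, lie_neg]
    · rw [hTzero y hy, ← lie_skew, ← lie_skew u (f y), hf y hy u hu, map_neg,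
        hTpos _ (G.mem_comp_of_lie_zero hy hu)]
    · rw [hTpos y hy, G.lie_eq_zero_of_mem_comp_one hu hy, map_zero,
        G.lie_eq_zero_of_mem_comp_one hu (G.mem_comp_of_lie_zero hA hy)]
  exact ⟨T, fun u y => LinearMap.congr_fun (LinearMap.congr_fun hFH u) y, hTpos⟩

/-- An element of `g₀` acting by a scalar on `g₁` is a multiple of the grading element. -/
theorem IsGradingElement.eq_smul_of_forall_lie_eq_smul [LieAlgebra.IsKilling 𝕜 g]
    [LieAlgebra.IsSimple 𝕜 g] (hE : G.IsGradingElement E) {b : g} (hb : b ∈ G.comp 0) {t : 𝕜}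
    (h : ∀ c ∈ G.comp 1, ⁅b, c⁆ = t • c) : b = t • E := by
  refine sub_eq_zero.1 (hE.eq_zero_of_forall_lie_eq_zero
    (sub_mem hb (Submodule.smul_mem _ t hE.mem)) fun c hc => ?_)
  have hEc : ⁅E, c⁆ = c := by simpa using hE 1 c hc
  rw [sub_lie, smul_lie, h c hc, hEc, sub_self]

theorem IsGradingElement.exists_mem_comp_one_ne_zero [LieAlgebra.IsKilling 𝕜 g]
    (hE : G.IsGradingElement E) :
    ∃ c ∈ G.comp 1, c ≠ 0 := by
  by_contra! h
  refine G.comp_neg_one_ne_bot ((Submodule.eq_bot_iff _).2 fun a ha =>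
    hE.eq_zero_of_forall_killingForm_eq_zero ha fun c hc => ?_)
  rw [neg_neg] at hc
  rw [h c hc, map_zero]

end Center

/-- The centre of `g₀` is spanned by the grading element, unless `g` is real and carries a complex
structure. -/
theorem IsGradingElement.exists_eq_smul_of_mem_center {𝕜 g : Type*} [RCLike 𝕜] [LieRing g]
    [LieAlgebra 𝕜 g] [FiniteDimensional 𝕜 g] [LieAlgebra.IsSimple 𝕜 g]
    {G : OneGrading 𝕜 g} {E : g} (hreal : (RCLike.I : 𝕜) = 0 → ¬ HasComplexStructure 𝕜 g)
    (hE : G.IsGradingElement E) {A : g} (hA : A ∈ G.comp 0)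
    (hcomm : ∀ b ∈ G.comp 0, ⁅A, b⁆ = 0) : ∃ t : 𝕜, A = t • E := by
  obtain ⟨T, hT, hTA⟩ := hE.exists_mem_lieCentroid hA hcomm
  obtain ⟨t, rfl⟩ := exists_eq_smul_one_of_mem_lieCentroid hreal hT
  exact ⟨t, hE.eq_smul_of_forall_lie_eq_smul hA fun c hc => by simpa using (hTA c hc).symm⟩

/-! ### The dimension of `g₁` -/

section Rank

variable {𝕜 g : Type*} [Field 𝕜] [CharZero 𝕜] [LieRing g] [LieAlgebra 𝕜 g]
  [FiniteDimensional 𝕜 g] [LieAlgebra.IsKilling 𝕜 g] [LieAlgebra.IsSimple 𝕜 g]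
  {G : OneGrading 𝕜 g} {E : g}

/-- If `g₁` were a line, then `g₀` would be spanned by the grading element `E`, and the generalized
null space of `ad E`, which is `g₀`, would bound the rank by one. -/
theorem IsGradingElement.exists_notMem_span (hE : G.IsGradingElement E)
    (hrank : 1 < LieAlgebra.rank 𝕜 g) (z : g) : ∃ c ∈ G.comp 1, c ∉ Submodule.span 𝕜 {z} := by
  by_contra! h
  obtain ⟨c₀, hc₀, hne⟩ := hE.exists_mem_comp_one_ne_zero
  have hline : ∀ c ∈ G.comp 1, ∃ t : 𝕜, c = t • c₀ := by
    intro c hc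
    obtain ⟨t, ht⟩ := Submodule.mem_span_singleton.1 (h c hc)
    obtain ⟨s, hs⟩ := Submodule.mem_span_singleton.1 (h c₀ hc₀)
    have hs0 : s ≠ 0 := by
      rintro rfl
      exact hne (by rw [← hs, zero_smul])
    exact ⟨t * s⁻¹, by rw [← hs, smul_smul, mul_assoc, inv_mul_cancel₀ hs0, mul_one, ht]⟩
  have hzero : ∀ b ∈ G.comp 0, ∃ t : 𝕜, b = t • E := by
    intro b hb
    obtain ⟨t, ht⟩ := hline _ (G.mem_comp_of_lie_zero hb hc₀)
    refine ⟨t, hE.eq_smul_of_forall_lie_eq_smul hb fun c hc => ?_⟩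
    obtain ⟨s, rfl⟩ := hline c hc
    rw [lie_smul, ht, smul_comm]
  have hle : (LieSubalgebra.engel 𝕜 E).toSubmodule ≤ Submodule.span 𝕜 {E} := by
    intro x hx
    obtain ⟨n, hn⟩ := (LieSubalgebra.mem_engel_iff 𝕜 E x).1 hx
    have hpow : ∀ n : ℕ, ∀ x, (LieAlgebra.ad 𝕜 g E ^ n) x = 0 → x ∈ G.comp 0 := by
      intro n
      induction n with
      | zero =>
        intro x hx
        have hx0 : x = 0 := hx
        rw [hx0]; exact zero_mem _
      | succ n ih =>
        intro x hx
        rw [pow_succ, Module.End.mul_apply] at hx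
        have h0 := ih _ hx
        exact hE.mem_comp_zero (by simpa using hE 0 _ h0)
    obtain ⟨t, rfl⟩ := hzero x (hpow n x hn)
    exact Submodule.smul_mem _ t (Submodule.mem_span_singleton_self E)
  have h1 := LieAlgebra.rank_le_finrank_engel 𝕜 E
  have h2 := (Submodule.finrank_mono hle).trans (finrank_span_le_card ({E} : Set g))
  rw [Set.toFinset_singleton, Finset.card_singleton] at h2
  exact absurd (hrank.trans_le (h1.trans h2)) (lt_irrefl _)

end Rank

/-! ### The map `∂` -/

section Del

variable {𝕜 g : Type*} [Field 𝕜] [LieRing g] [LieAlgebra 𝕜 g] (G : OneGrading 𝕜 g)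

/-- The bracket `g₁ × g₋₁ → g₀`. -/
def lieOneNegOne : G.comp 1 →ₗ[𝕜] G.comp (-1) →ₗ[𝕜] G.zero :=
  LinearMap.mk₂ 𝕜 (fun Z X => ⟨⁅(Z : g), (X : g)⁆, G.mem_comp_zero_of_lie Z.2 X.2⟩)
    (fun Z Z' X => Subtype.ext (by simp [add_lie]))
    (fun t Z X => Subtype.ext (by simp))
    (fun Z X X' => Subtype.ext (by simp [lie_add]))
    (fun t Z X => Subtype.ext (by simp))

/-- The trilinear map `(P, X, Y) ↦ ∂P(X, Y)`, with values in `g₀`. -/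
noncomputable def delHom :
    (G.comp (-1) →ₗ[𝕜] G.comp 1) →ₗ[𝕜] G.comp (-1) →ₗ[𝕜] G.comp (-1) →ₗ[𝕜] G.zero :=
  LinearMap.compRight 𝕜 G.lieOneNegOne -
    LinearMap.lflip.toLinearMap ∘ₗ LinearMap.compRight 𝕜 G.lieOneNegOne

/-- The map induced by `(P, X, Y) ↦ ∂P(X, Y)` on `g₁ ⊗ g₁ ⊗ g₋₁ ⊗ g₋₁`. -/
noncomputable def delTensor :
    ((G.comp 1 ⊗[𝕜] G.comp 1) ⊗[𝕜] G.comp (-1)) ⊗[𝕜] G.comp (-1) →ₗ[𝕜] G.zero :=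
  TensorProduct.lift (TensorProduct.lift (G.delHom ∘ₗ G.toHom))

theorem coe_delTensor (P : G.comp 1 ⊗[𝕜] G.comp 1) (X Y : G.comp (-1)) :
    (G.delTensor ((P ⊗ₜ[𝕜] X) ⊗ₜ[𝕜] Y) : g) = G.del (G.toHom P) X Y := rfl

/-- The restriction of `delTensor` to symmetric tensors in the first two factors. -/
noncomputable def delSymTensor :
    (G.symSq ⊗[𝕜] G.comp (-1)) ⊗[𝕜] G.comp (-1) →ₗ[𝕜] G.zero :=
  G.delTensor ∘ₗ LinearMap.rTensor _ (LinearMap.rTensor _ G.symSq.subtype)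

theorem coe_delSymTensor (P : G.symSq) (X Y : G.comp (-1)) :
    (G.delSymTensor ((P ⊗ₜ[𝕜] X) ⊗ₜ[𝕜] Y) : g) = G.del (G.toHom P) X Y := rfl

theorem toHom_tmul_apply (Z W : G.comp 1) (X : G.comp (-1)) :
    G.toHom (Z ⊗ₜ[𝕜] W) X = killingForm 𝕜 g Z X • W := rfl

/-- The transpose of the map `g₋₁ → g₁` attached to a tensor is attached to the flipped tensor. -/
theorem killingForm_toHom_comm (P : G.comp 1 ⊗[𝕜] G.comp 1) (X Y : G.comp (-1)) :
    killingForm 𝕜 g (G.toHom (TensorProduct.comm 𝕜 _ _ P) X) Y =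
      killingForm 𝕜 g (G.toHom P Y) X := by
  induction P using TensorProduct.induction_on with
  | zero => simp
  | tmul Z W =>
    rw [TensorProduct.comm_tmul, toHom_tmul_apply, toHom_tmul_apply]
    simp [mul_comm]
  | add P Q hP hQ =>
    simp only [map_add, LinearMap.add_apply, Submodule.coe_add, hP, hQ]

theorem mem_zeroSS_iff (y : G.zero) :
    y ∈ G.zeroSS ↔
      (y : g) ∈ Submodule.span 𝕜 {x | ∃ u ∈ G.comp 0, ∃ v ∈ G.comp 0, ⁅u, v⁆ = x} := by
  have himage : {x | ∃ u ∈ G.comp 0, ∃ v ∈ G.comp 0, ⁅u, v⁆ = x} =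
      (G.zero.incl : G.zero →ₗ[𝕜] g) ''
        {x | ∃ u ∈ (⊤ : LieIdeal 𝕜 G.zero), ∃ v ∈ (⊤ : LieIdeal 𝕜 G.zero), ⁅u, v⁆ = x} := by
    ext x
    constructor
    · rintro ⟨u, hu, v, hv, rfl⟩
      exact ⟨⁅(⟨u, hu⟩ : G.zero), (⟨v, hv⟩ : G.zero)⁆,
        ⟨⟨u, hu⟩, LieSubmodule.mem_top _, ⟨v, hv⟩, LieSubmodule.mem_top _, rfl⟩, rfl⟩
    · rintro ⟨_, ⟨u, _, v, _, rfl⟩, rfl⟩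
      exact ⟨u, u.2, v, v.2, rfl⟩
  have hspan : G.zeroSS.toSubmodule = Submodule.span 𝕜
      {x | ∃ u ∈ (⊤ : LieIdeal 𝕜 G.zero), ∃ v ∈ (⊤ : LieIdeal 𝕜 G.zero), ⁅u, v⁆ = x} :=
    LieSubmodule.lieIdeal_oper_eq_linear_span' _ _
  rw [himage, ← Submodule.map_span, ← hspan]
  constructor
  · intro hy
    exact ⟨y, hy, rfl⟩
  · rintro ⟨z, hz, hzy⟩
    rwa [← Subtype.ext hzy]

variable {G} {E : g}

theorem IsGradingElement.killingForm_del (hE : G.IsGradingElement E)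
    (P : G.comp (-1) →ₗ[𝕜] G.comp 1) (X Y : G.comp (-1)) :
    killingForm 𝕜 g E (G.del P X Y) =
      killingForm 𝕜 g (P X) Y - killingForm 𝕜 g (P Y) X := by
  have h : ∀ Z : G.comp 1, ⁅E, (Z : g)⁆ = Z := fun Z => by simpa using hE 1 Z Z.2
  rw [del, map_sub, ← LieModule.traceForm_apply_lie_apply,
    ← LieModule.traceForm_apply_lie_apply, h, h]

/-- For symmetric `P`, the element `∂P(X, Y)` is orthogonal to the grading element. -/
theorem IsGradingElement.killingForm_del_eq_zero (hE : G.IsGradingElement E)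
    (P : G.symSq) (X Y : G.comp (-1)) :
    killingForm 𝕜 g E (G.del (G.toHom P) X Y) = 0 := by
  have hP : TensorProduct.comm 𝕜 _ _ (P : G.comp 1 ⊗[𝕜] G.comp 1) = P := P.2
  rw [hE.killingForm_del, ← G.killingForm_toHom_comm, hP, sub_self]

theorem killingForm_del_tmul (b : g) (Z W : G.comp 1) (X Y : G.comp (-1)) :
    killingForm 𝕜 g b (G.del (G.toHom (Z ⊗ₜ[𝕜] W)) X Y) =
      killingForm 𝕜 g Z X * killingForm 𝕜 g ⁅b, (W : g)⁆ Y -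
        killingForm 𝕜 g Z Y * killingForm 𝕜 g ⁅b, (W : g)⁆ X := by
  rw [del, toHom_tmul_apply, toHom_tmul_apply, map_sub, ← LieModule.traceForm_apply_lie_apply,
    ← LieModule.traceForm_apply_lie_apply]
  simp

variable [CharZero 𝕜]

/-- If `b ∈ g₀` is orthogonal to all `∂(Z ⊗ W)(X, Y)`, then `[b, W]` is a multiple of `Z`. -/
theorem IsGradingElement.lie_mem_span [LieAlgebra.IsKilling 𝕜 g] (hE : G.IsGradingElement E)
    {b : g} (hb : b ∈ G.comp 0) {Z W : G.comp 1} (hZ : Z ≠ 0)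
    (h : ∀ X Y, killingForm 𝕜 g b (G.del (G.toHom (Z ⊗ₜ[𝕜] W)) X Y) = 0) :
    ∃ t : 𝕜, ⁅b, (W : g)⁆ = t • (Z : g) := by
  obtain ⟨X, hX, hZX⟩ : ∃ X ∈ G.comp (-1), killingForm 𝕜 g Z X ≠ 0 := by
    by_contra! hcon
    exact hZ (Subtype.ext (hE.eq_zero_of_forall_killingForm_eq_zero Z.2 hcon))
  have hbW := G.mem_comp_of_lie_zero hb W.2
  have hkey : killingForm 𝕜 g Z X • ⁅b, (W : g)⁆ = killingForm 𝕜 g ⁅b, (W : g)⁆ X • (Z : g) := by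
    rw [← sub_eq_zero]
    refine hE.eq_zero_of_forall_killingForm_eq_zero
      (sub_mem (Submodule.smul_mem _ _ hbW) (Submodule.smul_mem _ _ Z.2)) fun Y hY => ?_
    have h' := h ⟨X, hX⟩ ⟨Y, hY⟩
    rw [killingForm_del_tmul] at h'
    rw [map_sub, map_smul, map_smul, LinearMap.sub_apply, LinearMap.smul_apply,
      LinearMap.smul_apply, smul_eq_mul, smul_eq_mul, ← h']
    ring
  exact ⟨(killingForm 𝕜 g Z X)⁻¹ * killingForm 𝕜 g ⁅b, (W : g)⁆ X, by
    rw [mul_smul, ← hkey, inv_smul_smul₀ hZX]⟩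

variable [FiniteDimensional 𝕜 g] [LieAlgebra.IsKilling 𝕜 g] [LieAlgebra.IsSimple 𝕜 g]

/-- An element of `g₀` orthogonal to all `∂(Z ⊗ Z)(X, Y)` has every vector of `g₁` as an
eigenvector, so it is a multiple of the grading element. -/
theorem IsGradingElement.exists_eq_smul_of_forall_del_tmul_self (hE : G.IsGradingElement E)
    {b : g} (hb : b ∈ G.comp 0)
    (h : ∀ Z X Y, killingForm 𝕜 g b (G.del (G.toHom (Z ⊗ₜ[𝕜] Z)) X Y) = 0) :
    ∃ t : 𝕜, b = t • E := by
  let f : G.comp 1 →ₗ[𝕜] G.comp 1 :=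
    (LieAlgebra.ad 𝕜 g b).restrict fun c hc => G.mem_comp_of_lie_zero hb hc
  have hf : ∀ c, (f c : g) = ⁅b, (c : g)⁆ := fun c => rfl
  obtain ⟨t, ht⟩ := LinearMap.exists_eq_smul_id_of_forall_notLinearIndependent (f := f) (by
    intro Z hZ
    have hZ0 : Z ≠ 0 := by simpa using hZ.ne_zero 0
    obtain ⟨t, ht⟩ := hE.lie_mem_span hb hZ0 (h Z)
    have h1 := LinearIndependent.pair_iff.1 hZ t (-1) (by
      rw [show f Z = t • Z from Subtype.ext ht]
      module)
    exact one_ne_zero (neg_eq_zero.1 h1.2))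
  exact ⟨t, hE.eq_smul_of_forall_lie_eq_smul hb fun c hc => by
    rw [← hf ⟨c, hc⟩, ht]; rfl⟩

/-- The image of symmetric tensors contains `[g₀, g₀]`: an element of `g₀` orthogonal to the image
is a multiple of the grading element, and this is orthogonal to all brackets. -/
theorem IsGradingElement.le_map_range_delSymTensor (hE : G.IsGradingElement E) :
    Submodule.span 𝕜 {x | ∃ u ∈ G.comp 0, ∃ v ∈ G.comp 0, ⁅u, v⁆ = x} ≤
      (LinearMap.range G.delSymTensor).map G.zero.toSubmodule.subtype := by
  refine hE.le_of_forall_killingForm_eq_zero (Submodule.span_le.2 ?_) ?_ ?_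
  · rintro _ ⟨u, hu, v, hv, rfl⟩
    exact G.mem_comp_of_lie_zero hu hv
  · rintro _ ⟨y, _, rfl⟩
    exact y.2
  · intro b hb h s hs
    obtain ⟨t, rfl⟩ := hE.exists_eq_smul_of_forall_del_tmul_self hb fun Z X Y =>
      h _ ⟨_, ⟨((⟨Z ⊗ₜ[𝕜] Z, TensorProduct.comm_tmul 𝕜 _ _ Z Z⟩ : G.symSq) ⊗ₜ[𝕜] X) ⊗ₜ[𝕜] Y, rfl⟩,
        rfl⟩
    refine (Submodule.span_le (p := LinearMap.ker (killingForm 𝕜 g (t • E)))).2 ?_ hs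
    rintro _ ⟨u, hu, v, hv, rfl⟩
    have hEu : ⁅E, u⁆ = 0 := by simpa using hE 0 u hu
    change killingForm 𝕜 g (t • E) ⁅u, v⁆ = 0
    rw [map_smul, LinearMap.smul_apply, ← LieModule.traceForm_apply_lie_apply, hEu, map_zero,
      LinearMap.zero_apply, smul_zero]

/-- Rank bigger than one makes `dim g₁ > 1`, and then no nonzero element of `g₀` is orthogonal to
all `∂(Z ⊗ W)(X, Y)`. -/
theorem IsGradingElement.surjective_delTensor (hE : G.IsGradingElement E)
    (hrank : 1 < LieAlgebra.rank 𝕜 g) : Function.Surjective G.delTensor := by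
  have hle : G.comp 0 ≤ (LinearMap.range G.delTensor).map G.zero.toSubmodule.subtype := by
    refine hE.le_of_forall_killingForm_eq_zero le_rfl ?_ ?_
    · rintro _ ⟨y, _, rfl⟩
      exact y.2
    · intro b hb h s _
      have hmem : ∀ Z W : G.comp 1, Z ≠ 0 → ∃ t : 𝕜, ⁅b, (W : g)⁆ = t • (Z : g) :=
        fun Z W hZ => hE.lie_mem_span hb hZ fun X Y =>
          h _ ⟨_, ⟨((Z ⊗ₜ[𝕜] W) ⊗ₜ[𝕜] X) ⊗ₜ[𝕜] Y, rfl⟩, rfl⟩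
      obtain ⟨Z, hZ, hZ0⟩ := hE.exists_mem_comp_one_ne_zero
      obtain ⟨Z', hZ', hZZ'⟩ := hE.exists_notMem_span hrank Z
      have hb0 : b = 0 := by
        refine hE.eq_zero_of_forall_lie_eq_zero hb fun W hW => ?_
        -- `[b, W]` is a multiple of two linearly independent vectors
        obtain ⟨t, ht⟩ := hmem ⟨Z, hZ⟩ ⟨W, hW⟩ fun h0 => hZ0 (congrArg Subtype.val h0)
        obtain ⟨t', ht'⟩ := hmem ⟨Z', hZ'⟩ ⟨W, hW⟩ fun h0 => hZZ' (by
          rw [show Z' = 0 from congrArg Subtype.val h0]; exact zero_mem _)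
        simp only at ht ht'
        by_cases ht0 : t' = 0
        · rw [ht', ht0, zero_smul]
        · refine absurd (Submodule.mem_span_singleton.2 ⟨t'⁻¹ * t, ?_⟩) hZZ'
          rw [mul_smul, ← ht, ht', inv_smul_smul₀ ht0]
      simp [hb0]
  intro y
  obtain ⟨z, ⟨w, rfl⟩, hz⟩ := hle y.2
  exact ⟨w, Subtype.ext hz⟩

end Del

/-- The image of symmetric tensors lies in `[g₀, g₀]`: the orthogonal complement of `[g₀, g₀]` in
`g₀` is the centre of `g₀`, which the grading element spans. -/
theorem IsGradingElement.delSymTensor_mem_zeroSS {𝕜 g : Type*} [RCLike 𝕜] [LieRing g]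
    [LieAlgebra 𝕜 g] [FiniteDimensional 𝕜 g] [LieAlgebra.IsSimple 𝕜 g]
    {G : OneGrading 𝕜 g} {E : g} (hreal : (RCLike.I : 𝕜) = 0 → ¬ HasComplexStructure 𝕜 g)
    (hE : G.IsGradingElement E) (w : (G.symSq ⊗[𝕜] G.comp (-1)) ⊗[𝕜] G.comp (-1)) :
    G.delSymTensor w ∈ G.zeroSS := by
  have hle : (LinearMap.range G.delSymTensor).map G.zero.toSubmodule.subtype ≤
      Submodule.span 𝕜 {x | ∃ u ∈ G.comp 0, ∃ v ∈ G.comp 0, ⁅u, v⁆ = x} := by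
    refine hE.le_of_forall_killingForm_eq_zero ?_ (Submodule.span_le.2 ?_) ?_
    · rintro _ ⟨y, _, rfl⟩
      exact y.2
    · rintro _ ⟨u, hu, v, hv, rfl⟩
      exact G.mem_comp_of_lie_zero hu hv
    · intro b hb h
      obtain ⟨t, rfl⟩ := hE.exists_eq_smul_of_mem_center hreal hb fun u hu =>
        hE.eq_zero_of_forall_killingForm_eq_zero (i := 0) (G.mem_comp_of_lie_zero hb hu)
          fun v hv => by
            rw [LieModule.traceForm_apply_lie_apply]
            exact h _ (Submodule.subset_span ⟨u, hu, v, by simpa using hv, rfl⟩)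
      have hzero : ((killingForm 𝕜 g (t • E)) ∘ₗ G.zero.toSubmodule.subtype) ∘ₗ
          G.delSymTensor = 0 := by
        ext P X Y
        change killingForm 𝕜 g (t • E) (G.del (G.toHom P) X Y) = 0
        rw [map_smul, LinearMap.smul_apply, hE.killingForm_del_eq_zero, smul_zero]
      rintro _ ⟨_, ⟨w, rfl⟩, rfl⟩
      exact LinearMap.congr_fun hzero w
  exact (G.mem_zeroSS_iff _).2 (hle ⟨_, ⟨w, rfl⟩, rfl⟩)

end OneGrading

theorem mainTheorem4 {𝕜 g : Type*} [RCLike 𝕜] [LieRing g] [LieAlgebra 𝕜 g]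
    [FiniteDimensional 𝕜 g] [LieAlgebra.IsSimple 𝕜 g]
    (hrank : 1 < LieAlgebra.rank 𝕜 g)
    -- if `𝕜 = ℝ`, then `g` is not a complex Lie algebra regarded as a real one
    (hreal : (RCLike.I : 𝕜) = 0 → ¬ HasComplexStructure 𝕜 g)
    (G : OneGrading 𝕜 g) :
    (∃ φ : (G.symSq ⊗[𝕜] G.comp (-1)) ⊗[𝕜] G.comp (-1) →ₗ[𝕜] G.zeroSS,
      (∀ (P : G.symSq) (X Y : G.comp (-1)),
        ((φ ((P ⊗ₜ[𝕜] X) ⊗ₜ[𝕜] Y) : G.zero) : g) = G.del (G.toHom P) X Y) ∧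
      Function.Surjective φ) ∧
    (∃ ψ : ((G.comp 1 ⊗[𝕜] G.comp 1) ⊗[𝕜] G.comp (-1)) ⊗[𝕜] G.comp (-1) →ₗ[𝕜] G.zero,
      (∀ (P : G.comp 1 ⊗[𝕜] G.comp 1) (X Y : G.comp (-1)),
        ((ψ ((P ⊗ₜ[𝕜] X) ⊗ₜ[𝕜] Y) : G.zero) : g) = G.del (G.toHom P) X Y) ∧
      Function.Surjective ψ) := by
  obtain ⟨E, hE⟩ := G.exists_isGradingElement
  refine ⟨⟨G.delSymTensor.codRestrict G.zeroSS.toSubmodule (hE.delSymTensor_mem_zeroSS hreal),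
    fun P X Y => G.coe_delSymTensor P X Y, fun y => ?_⟩,
    ⟨G.delTensor, G.coe_delTensor, hE.surjective_delTensor hrank⟩⟩
  obtain ⟨_, ⟨w, rfl⟩, hw⟩ := hE.le_map_range_delSymTensor ((G.mem_zeroSS_iff y).1 y.2)
  exact ⟨w, Subtype.ext (Subtype.ext hw)⟩
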